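/- Fix $T,N\in\mathbb N$. Let ${\cal X}=\prod_{t=1}^T{\cal X}_t$ and ${\cal Y}=\prod_{t=1}^T{\cal Y}_t$, where the ${\cal X}_t$ are Polish spaces and the $({\cal Y}_t,d_{{\cal Y}_t})$ are complete separable metric spaces, and put $d_{\cal Y}(y,\tilde y)=\sum_{t=1}^T d_{{\cal Y}_t}(y_t,\tilde y_t)$. A filtered process $\mathbb Z=(\Omega^{\mathbb Z},{\cal F}^{\mathbb Z},\mathbb F^{\mathbb Z},\mathbb P^{\mathbb Z},Z)$ with values in a path space $\prod_{t=1}^T{\cal S}_t$ consists of a product $\Omega^{\mathbb Z}=\prod_{t=1}^T\Omega^{\mathbb Z}_t$ of Polish spaces with its Borel $\sigma$-algebra ${\cal F}^{\mathbb Z}={\cal F}^{\mathbb Z}_T$, the canonical filtration ${\cal F}^{\mathbb Z}_t=\sigma(\omega_1,\dots,\omega_t)$, a probability measure $\mathbb P^{\mathbb Z}$ on $\Omega^{\mathbb Z}$, and an adapted process $Z=(Z_t)_{t=1}^T$ with $Z_t\in{\cal S}_t$. Let ${\rm FP}({\cal Y})$ be the class of ${\cal Y}$-valued filtered processes, and ${\rm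 FP}_1({\cal Y})$ the class of those $\mathbb Y$ with $\mathbb E_{\mathbb P^{\mathbb Y}}[d_{\cal Y}(Y,\hat y)]<\infty$ for some $\hat y\in{\cal Y}$. For $\mu\in{\cal P}({\cal Y})$ let $\mathbb Y^\mu=({\cal Y},{\cal F}^Y_T,(\mathcal F^Y_t)_{t=1}^T,\mu,Y)$, where $Y$ is the coordinate process on ${\cal Y}$ and ${\cal F}^Y_t=\sigma(Y_1,\dots,Y_t)$ is its canonical filtration. A causal coupling of $\mathbb X$ and $\mathbb Y$ is a probability measure $\pi$ on $\Omega^{\mathbb X}\times\Omega^{\mathbb Y}$ with marginals $\mathbb P^{\mathbb X}$ and $\mathbb P^{\mathbb Y}$ such that, for every $t\in\{1,\dots,T\}$, under $\pi$, the $\sigma$-algebras ${\cal F}^{\mathbb X}_T\otimes\{\emptyset,\Omega^{\mathbb Y}\}$ and $\{\emptyset,\Omega^{\mathbb X}\}\otimes{\cal F}^{\mathbb Y}_t$ are conditionally independent given ${\cal F}^{\mathbb X}_t\otimes\{\emptyset,\Omega^{\mathbb Y}\}$. For $c:{\cal X}\times{\cal Y}\to\mathbb R$ measurable and bounded below let ${\cal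 CW}_c(\mathbb X,\mathbb Y)=\inf_\pi\mathbb E_\pi[c(X,Y)]\in(-\infty,\infty]$, the infimum being over all causal couplings $\pi$ of $\mathbb X$ and $\mathbb Y$. Let $\mathbb X^1,\dots,\mathbb X^N$ be ${\cal X}$-valued filtered processes, let $c^1,\dots,c^N:{\cal X}\times{\cal Y}\to\mathbb R$, and put $$B^{\rm c}_{c^{1:N}}(\mathbb Y)=\sum_{i=1}^N{\cal CW}_{c^i}(\mathbb X^i,\mathbb Y),\qquad B^{\rm c}_{c^{1:N}}=\inf_{\mathbb Y\in{\rm FP}({\cal Y})}B^{\rm c}_{c^{1:N}}(\mathbb Y).$$ **Theorem.** Assume that 1. every $c^i$ is lower semicontinuous and bounded below; 2. there is $y^0\in{\cal Y}$ such that $\{y\in{\cal Y}: d_{\cal Y}(y^0,y)\le K\}$ is compact for every $K\ge0$, and the deterministic process $\mathbb Y^0$ with $Y^0\equiv y^0$ satisfies $B^{\rm c}_{c^{1:N}}(\mathbb Y^0)<\infty$; 3. there are $C\ge0$ and $\ell^1\in\mathbb L^1({\rm Law}_{\mathbb P^1}(X^1))$ such that $d_{\cal Y}(y^0,y)\le C\,(1+c^1(x,y)+\ell^1(x))$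 for all $(x,y)\in{\cal X}\times{\cal Y}$. Then there exists a causal barycenter, that is, some $\bar{\mathbb Y}\in{\rm FP}({\cal Y})$ with $B^{\rm c}_{c^{1:N}}(\bar{\mathbb Y})=B^{\rm c}_{c^{1:N}}$. It can be taken with canonical filtration: $\bar{\mathbb Y}=\mathbb Y^\mu$ for some $\mu\in{\cal P}({\cal Y})$. Moreover, every $\bar{\mathbb Y}\in{\rm FP}({\cal Y})$ with $B^{\rm c}_{c^{1:N}}(\bar{\mathbb Y})=B^{\rm c}_{c^{1:N}}$ lies in ${\rm FP}_1({\cal Y})$. -/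

import Mathlib

open MeasureTheory ProbabilityTheory
open scoped ENNReal

universe u v w

/-- The metric `d(y, y') = ∑ₜ dₜ(yₜ, y'ₜ)` on a product of metric spaces. -/
noncomputable def pathDist {T : ℕ} {S : Fin T → Type u} [∀ t, MetricSpace (S t)]
    (y y' : ∀ t, S t) : ℝ :=
  ∑ t, dist (y t) (y' t)

/-- A filtered process with values in the path space `∏ₜ Sₜ`: the sample space is a product
`Ω = ∏ₜ Ωₜ` of Polish spaces with their Borel σ-algebras, the filtration is the canonical one
(`Filtration.piLE t` is generated by the coordinates `ω_s`, `s ≤ t`), `P` is a probability measure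
on `Ω`, and `proc` is an adapted process. The time set `{1, …, T}` is modelled by `Fin T`. -/
structure FilteredProcess {T : ℕ} (S : Fin T → Type u) [∀ t, MeasurableSpace (S t)] where
  Ω : Fin T → Type v
  [top : ∀ t, TopologicalSpace (Ω t)]
  [polish : ∀ t, PolishSpace (Ω t)]
  [meas : ∀ t, MeasurableSpace (Ω t)]
  [borel : ∀ t, BorelSpace (Ω t)]
  P : Measure (∀ t, Ω t)
  [prob : IsProbabilityMeasure P]
  proc : (∀ t, Ω t) → ∀ t, S t
  adapted : ∀ t, Measurable[Filtration.piLE (X := Ω) t] (fun ω => proc ω t)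

attribute [instance] FilteredProcess.top FilteredProcess.polish FilteredProcess.meas
  FilteredProcess.borel FilteredProcess.prob

namespace FilteredProcess

/-- The process `𝕐^μ`: the canonical process on the path space with its canonical filtration,
under the law `μ`. -/
noncomputable def canonical {T : ℕ} {S : Fin T → Type u} [∀ t, TopologicalSpace (S t)]
    [∀ t, PolishSpace (S t)] [∀ t, MeasurableSpace (S t)] [∀ t, BorelSpace (S t)]
    (μ : ProbabilityMeasure (∀ t, S t)) : FilteredProcess.{u, u} S where
  Ω := S
  P := (μ : Measure (∀ t, S t))
  proc := fun ω => ω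
  adapted := fun t => by
    have h : Measurable[MeasurableSpace.comap (Preorder.restrictLe t) MeasurableSpace.pi]
        (Preorder.restrictLe (π := S) t) := comap_measurable _
    exact (measurable_pi_apply (⟨t, Set.mem_Iic.2 le_rfl⟩ : Set.Iic t)).comp h

/-- The deterministic process `Y ≡ y⁰`, on a one-point sample space. -/
noncomputable def const {T : ℕ} {S : Fin T → Type u} [∀ t, MeasurableSpace (S t)]
    (y₀ : ∀ t, S t) : FilteredProcess.{u, v} S where
  Ω := fun _ => PUnit
  top := fun _ => ⊥
  polish := fun _ => by
    let _ : TopologicalSpace PUnit.{v + 1} := ⊥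
    have : DiscreteTopology PUnit.{v + 1} := ⟨rfl⟩
    infer_instance
  meas := fun _ => ⊤
  borel := fun _ => by
    let _ : TopologicalSpace PUnit.{v + 1} := ⊥
    have : DiscreteTopology PUnit.{v + 1} := ⟨rfl⟩
    let _ : MeasurableSpace PUnit.{v + 1} := ⊤
    exact ⟨borel_eq_top_of_discrete.symm⟩
  P := Measure.dirac (fun _ => PUnit.unit)
  proc := fun _ => y₀
  adapted := fun _ => measurable_const

/-- Finite first moment: `E[d(Y, ŷ)] < ∞` for some `ŷ`, i.e. membership in `FP₁`. -/
def HasFiniteFirstMoment {T : ℕ} {S : Fin T → Type u} [∀ t, MetricSpace (S t)]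
    [∀ t, MeasurableSpace (S t)] (Y : FilteredProcess.{u, v} S) : Prop :=
  ∃ y' : ∀ t, S t, Integrable (fun ω => pathDist (Y.proc ω) y') Y.P

end FilteredProcess

section Causal

variable {T : ℕ} {S : Fin T → Type u} {R : Fin T → Type v}
  [∀ t, MeasurableSpace (S t)] [∀ t, MeasurableSpace (R t)]

/-- `π` is a causal coupling of `𝕏` and `𝕐`: its marginals are `P^𝕏` and `P^𝕐`, and, for every `t`,
under `π`, `F^𝕏_T ⊗ {∅, Ω^𝕐}` is conditionally independent of `{∅, Ω^𝕏} ⊗ F^𝕐_t` given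
`F^𝕏_t ⊗ {∅, Ω^𝕐}`. -/
structure IsCausalCoupling (𝕏 : FilteredProcess.{u, w} S) (𝕐 : FilteredProcess.{v, v} R)
    (π : ProbabilityMeasure ((∀ t, 𝕏.Ω t) × (∀ t, 𝕐.Ω t))) : Prop where
  map_fst : (π : Measure ((∀ t, 𝕏.Ω t) × (∀ t, 𝕐.Ω t))).map Prod.fst = 𝕏.P
  map_snd : (π : Measure ((∀ t, 𝕏.Ω t) × (∀ t, 𝕐.Ω t))).map Prod.snd = 𝕐.P
  causal : ∀ t : Fin T,
    CondIndep
      ((Filtration.piLE (X := 𝕏.Ω) t).comap Prod.fst)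
      ((MeasurableSpace.pi : MeasurableSpace (∀ t, 𝕏.Ω t)).comap Prod.fst)
      ((Filtration.piLE (X := 𝕐.Ω) t).comap Prod.snd)
      (((MeasurableSpace.comap_mono (Filtration.le _ t)).trans measurable_fst.comap_le))
      (π : Measure ((∀ t, 𝕏.Ω t) × (∀ t, 𝕐.Ω t)))

/-- The expectation of a real function as an extended real, `∫ f⁺ - ∫ f⁻`. It is the usual
expectation in `(-∞, ∞]` when `f` is measurable and bounded below. -/
noncomputable def erealExpectation {Ω : Type*} [MeasurableSpace Ω] (μ : Measure Ω) (f : Ω → ℝ) :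
    EReal :=
  ((∫⁻ ω, ENNReal.ofReal (f ω) ∂μ : ℝ≥0∞) : EReal)
    - ((∫⁻ ω, ENNReal.ofReal (-f ω) ∂μ : ℝ≥0∞) : EReal)

/-- The causal transport value `CW_c(𝕏, 𝕐) = inf_π E_π[c(X, Y)]`, over causal couplings `π`. -/
noncomputable def causalValue (c : (∀ t, S t) × (∀ t, R t) → ℝ)
    (𝕏 : FilteredProcess.{u, w} S) (𝕐 : FilteredProcess.{v, v} R) : EReal :=
  ⨅ (π : ProbabilityMeasure ((∀ t, 𝕏.Ω t) × (∀ t, 𝕐.Ω t))) (_ : IsCausalCoupling 𝕏 𝕐 π),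
    erealExpectation (π : Measure ((∀ t, 𝕏.Ω t) × (∀ t, 𝕐.Ω t)))
      (fun ω => c (𝕏.proc ω.1, 𝕐.proc ω.2))

/-- The causal barycenter functional `𝕐 ↦ ∑ᵢ CW_{cⁱ}(𝕏ⁱ, 𝕐)`. -/
noncomputable def causalBaryFunctional {N : ℕ} (c : Fin N → (∀ t, S t) × (∀ t, R t) → ℝ)
    (𝕏 : Fin N → FilteredProcess.{u, w} S) (𝕐 : FilteredProcess.{v, v} R) : EReal :=
  ∑ i, causalValue (c i) (𝕏 i) 𝕐

/-- The value of the causal barycenter problem, the infimum over all filtered processes. -/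
noncomputable def causalBaryValue {N : ℕ} (c : Fin N → (∀ t, S t) × (∀ t, R t) → ℝ)
    (𝕏 : Fin N → FilteredProcess.{u, w} S) : EReal :=
  ⨅ 𝕐 : FilteredProcess.{v, v} R, causalBaryFunctional c 𝕏 𝕐

/-- `𝕐` solves the causal barycenter problem. -/
def IsCausalBarycenter {N : ℕ} (c : Fin N → (∀ t, S t) × (∀ t, R t) → ℝ)
    (𝕏 : Fin N → FilteredProcess.{u, w} S) (𝕐 : FilteredProcess.{v, v} R) : Prop :=
  causalBaryFunctional c 𝕏 𝕐 = causalBaryValue (R := R) c 𝕏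

end Causal

open Filter Topology BoundedContinuousFunction

/-! The proof is the direct method of the calculus of variations, applied to laws on the path space
instead of to filtered processes. Pushing a causal coupling of `𝕏` and `𝕐` forward along `Y` gives a
causal coupling of `𝕏` with the canonical process under the law of `Y`, at the same cost
(`IsCausalCoupling.map_canonical`). So only canonical processes compete, and the unknown is a single
measure `μ`.

Lower semicontinuity in `μ` (`lowerSemicontinuous_causalValueENNReal_canonical`) needs causality to
survive weak limits. Causality says that `1_A - P(A | F_t)`, a function of `ω` alone, is orthogonal
under `π` to bounded continuous functions of the path of `Y` up to `t` (`condIndep_comap_iff`,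
`forall_measureReal_prod_eq_iff`). The first factor is merely measurable, but all couplings share
their first marginal, so weak convergence extends to such test functions
(`exists_tendsto_coupling_subseq`).

Compactness comes from the growth condition: a bound on the first transport value bounds the moment
of `d(y⁰, Y)`. Balls are compact, so sublevel sets are tight. The same moment bound puts every
minimiser in `FP₁`. -/

/-! ### Conditional independence on a product space -/

/-- Conditional expectation commutes with pulling back along a measurable map. -/
theorem condExp_comap_comp {α β : Type*} {m : MeasurableSpace β} {mα : MeasurableSpace α}
    {mβ : MeasurableSpace β} (hm : m ≤ mβ) {μ : Measure α} [IsFiniteMeasure μ] {f : α → β}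
    (hf : Measurable f) {g : β → ℝ} (hg : Integrable g (μ.map f)) :
    μ[g ∘ f | m.comap f] =ᵐ[μ] (μ.map f)[g | m] ∘ f := by
  have hle : m.comap f ≤ mα := (MeasurableSpace.comap_mono hm).trans hf.comap_le
  have hint : Integrable ((μ.map f)[g | m] ∘ f) μ :=
    (integrable_map_measure integrable_condExp.aestronglyMeasurable hf.aemeasurable).1
      integrable_condExp
  refine (ae_eq_condExp_of_forall_setIntegral_eq hle
    ((integrable_map_measure hg.aestronglyMeasurable hf.aemeasurable).1 hg)
    (fun s _ _ => hint.integrableOn) ?_ ?_).symm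
  · rintro _ ⟨s, hs, rfl⟩ -
    have e1 := setIntegral_map (hm s hs) (integrable_condExp (m := m) (f := g)
      (μ := μ.map f)).aestronglyMeasurable hf.aemeasurable
    have e2 := setIntegral_map (hm s hs) hg.aestronglyMeasurable hf.aemeasurable
    exact e1.symm.trans ((setIntegral_condExp hm hg hs).trans e2)
  · exact (stronglyMeasurable_condExp.comp_measurable (comap_measurable f)).aestronglyMeasurable

/-- Conditional independence of the first coordinate and a sub-σ-algebra of the second one, given a
sub-σ-algebra of the first one, in terms of the conditional probabilities of the first marginal. -/
theorem condIndep_comap_iff {Ω Ω' : Type*} {m : MeasurableSpace Ω} {m' : MeasurableSpace Ω'}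
    {mΩ : MeasurableSpace Ω} {mΩ' : MeasurableSpace Ω'} [StandardBorelSpace (Ω × Ω')]
    (hm : m ≤ mΩ) (hm' : m' ≤ mΩ')
    (h : m.comap (Prod.fst : Ω × Ω' → Ω) ≤ Prod.instMeasurableSpace)
    (π : Measure (Ω × Ω')) [IsProbabilityMeasure π] :
    CondIndep (m.comap Prod.fst) (mΩ.comap Prod.fst) (m'.comap Prod.snd) h π ↔
      ∀ A B, MeasurableSet A → MeasurableSet[m'] B →
        π.real (A ×ˢ B) = ∫ z in Prod.snd ⁻¹' B, ((π.map Prod.fst)⟦A | m⟧) z.1 ∂π := by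
  rw [condIndep_iff _ _ _ h measurable_fst.comap_le
    ((MeasurableSpace.comap_mono hm').trans measurable_snd.comap_le)]
  have key : ∀ A, MeasurableSet A → π⟦Prod.fst ⁻¹' A | m.comap Prod.fst⟧ =ᵐ[π]
      (π.map Prod.fst)⟦A | m⟧ ∘ Prod.fst := fun A hA =>
    condExp_comap_comp hm measurable_fst ((integrable_const (1 : ℝ)).indicator hA)
  have hind : ∀ {s : Set (Ω × Ω')}, MeasurableSet s →
      Integrable (s.indicator fun _ => (1 : ℝ)) π :=
    fun hs => (integrable_const (1 : ℝ)).indicator hs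
  have hbdd : ∀ A, MeasurableSet A →
      ∀ᵐ z ∂π, ‖(π⟦Prod.fst ⁻¹' A | m.comap Prod.fst⟧) z‖ ≤ 1 := by
    intro A hA
    refine (ae_bdd_abs_condExp_of_ae_bdd_abs (R := (1 : ℝ)) (ae_of_all _ fun z => ?_))
    by_cases hz : z ∈ Prod.fst ⁻¹' A <;> simp [hz]
  -- Pulling out the known factor turns the product of conditional probabilities into one
  -- conditional expectation, of `P(A | m)` on the event `B`.
  have hprod : ∀ A B, MeasurableSet A → MeasurableSet[m'] B →
      π[(Prod.snd ⁻¹' B).indicator (π⟦Prod.fst ⁻¹' A | m.comap Prod.fst⟧) | m.comap Prod.fst]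
        =ᵐ[π] π⟦Prod.fst ⁻¹' A | m.comap Prod.fst⟧ * π⟦Prod.snd ⁻¹' B | m.comap Prod.fst⟧ := by
    intro A B hA hB
    have hB' : MeasurableSet ((Prod.snd : Ω × Ω' → Ω') ⁻¹' B) := measurable_snd (hm' _ hB)
    have e : (Prod.snd ⁻¹' B).indicator (π⟦Prod.fst ⁻¹' A | m.comap Prod.fst⟧) =
        (π⟦Prod.fst ⁻¹' A | m.comap Prod.fst⟧) * (Prod.snd ⁻¹' B).indicator fun _ => (1 : ℝ) := by
      ext z
      by_cases hz : z ∈ (Prod.snd : Ω × Ω' → Ω') ⁻¹' B <;> simp [hz]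
    rw [e]
    refine condExp_stronglyMeasurable_mul_of_bound h stronglyMeasurable_condExp (hind hB') 1
      (hbdd A hA)
  constructor
  · intro H A B hA hB
    have hB' : MeasurableSet ((Prod.snd : Ω × Ω' → Ω') ⁻¹' B) := measurable_snd (hm' _ hB)
    have h1 := (H _ _ ⟨A, hA, rfl⟩ ⟨B, hB, rfl⟩).trans (hprod A B hA hB).symm
    have h2 := integral_congr_ae h1
    rw [integral_condExp h, integral_condExp h, integral_indicator_const _
      ((measurable_fst hA).inter hB'), integral_indicator hB'] at h2
    rw [Set.prod_eq]
    simp only [smul_eq_mul, mul_one] at h2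
    rw [h2]
    exact integral_congr_ae (ae_restrict_of_ae (key A hA))
  · rintro H _ _ ⟨A, hA, rfl⟩ ⟨B, hB, rfl⟩
    have hB' : MeasurableSet ((Prod.snd : Ω × Ω' → Ω') ⁻¹' B) := measurable_snd (hm' _ hB)
    have hA' : MeasurableSet ((Prod.fst : Ω × Ω' → Ω) ⁻¹' A) := measurable_fst hA
    refine EventuallyEq.trans ?_ (hprod A B hA hB)
    refine EventuallyEq.symm (ae_eq_condExp_of_forall_setIntegral_eq h (hind (hA'.inter hB'))
      (fun s _ _ => integrable_condExp.integrableOn) ?_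
      stronglyMeasurable_condExp.aestronglyMeasurable)
    rintro _ ⟨D, hD, rfl⟩ -
    have hDm : MeasurableSet ((Prod.fst : Ω × Ω' → Ω) ⁻¹' D) := measurable_fst (hm _ hD)
    rw [setIntegral_condExp h (integrable_condExp.indicator hB') ⟨D, hD, rfl⟩,
      setIntegral_indicator hB', setIntegral_indicator (hA'.inter hB'), setIntegral_const,
      smul_eq_mul, mul_one]
    have e : (Prod.fst : Ω × Ω' → Ω) ⁻¹' D ∩ (Prod.fst ⁻¹' A ∩ Prod.snd ⁻¹' B) =
        (A ∩ D) ×ˢ B := by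
      ext z; simp; tauto
    -- The hypothesis only equates integrals over the whole space. Using it for `A ∩ D` with `D` in
    -- `m` localises it to `D`, since `P(A ∩ D | m) = 1_D P(A | m)`.
    rw [e, H (A ∩ D) B (hA.inter (hm _ hD)) hB]
    have hloc : (π.map Prod.fst)⟦A ∩ D | m⟧ =ᵐ[π.map Prod.fst]
        D.indicator ((π.map Prod.fst)⟦A | m⟧) := by
      have := condExp_indicator (m := m) (μ := π.map Prod.fst)
        (f := A.indicator fun _ => (1 : ℝ)) ((integrable_const (1 : ℝ)).indicator hA) hD
      rwa [Set.indicator_indicator, Set.inter_comm] at this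
    have hloc' := ae_of_ae_map measurable_fst.aemeasurable hloc
    symm
    calc _ = ∫ z in Prod.snd ⁻¹' B, (Prod.fst ⁻¹' D).indicator
          (π⟦Prod.fst ⁻¹' A | m.comap Prod.fst⟧) z ∂π := by
          refine integral_congr_ae (ae_restrict_of_ae ?_)
          filter_upwards [hloc', key A hA] with z h1 h2
          rw [h1]
          by_cases hz : z.1 ∈ D <;> simp [Set.indicator, hz, h2]
      _ = _ := by rw [setIntegral_indicator hDm, Set.inter_comm]

/-! ### Weak limits of couplings with a fixed first marginal -/

/-- Weak convergence makes the integral of a nonnegative lower semicontinuous function lower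
semicontinuous. -/
theorem LowerSemicontinuous.lintegral_ofReal_le_liminf {Z : Type*} [TopologicalSpace Z]
    [MeasurableSpace Z] [OpensMeasurableSpace Z] [HasOuterApproxClosed Z]
    {f : Z → ℝ} (hf : LowerSemicontinuous f) (h0 : 0 ≤ f)
    {μs : ℕ → ProbabilityMeasure Z} {μ : ProbabilityMeasure Z} (hμ : Tendsto μs atTop (𝓝 μ)) :
    ∫⁻ z, ENNReal.ofReal (f z) ∂(μ : Measure Z) ≤
      atTop.liminf fun n => ∫⁻ z, ENNReal.ofReal (f z) ∂(μs n : Measure Z) := by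
  -- Layer cake: superlevel sets are open, so the portmanteau theorem applies at each level and
  -- Fatou's lemma integrates over levels.
  simp_rw [lintegral_eq_lintegral_meas_lt _ (Eventually.of_forall h0) hf.measurable.aemeasurable]
  refine (lintegral_mono fun t => ?_).trans (lintegral_liminf_le fun n => Antitone.measurable
    fun s t hst => measure_mono fun ω hω => lt_of_le_of_lt hst hω)
  exact ProbabilityMeasure.le_liminf_measure_open_of_tendsto hμ (hf.isOpen_preimage t)

/-- For couplings with a fixed first marginal, weak convergence passes to test functions that are
merely integrable in the first variable. -/
theorem tendsto_integral_mul_of_map_fst_eq {Ω E : Type*}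
    [TopologicalSpace Ω] [PolishSpace Ω] [MeasurableSpace Ω] [BorelSpace Ω]
    [TopologicalSpace E] [PolishSpace E] [MeasurableSpace E] [BorelSpace E]
    {P : Measure Ω} [IsProbabilityMeasure P]
    {π : ℕ → ProbabilityMeasure (Ω × E)} {ρ : ProbabilityMeasure (Ω × E)}
    (hπ : ∀ n, (π n : Measure (Ω × E)).map Prod.fst = P)
    (hρ : (ρ : Measure (Ω × E)).map Prod.fst = P) (hlim : Tendsto π atTop (𝓝 ρ))
    {a : Ω → ℝ} (ha : Integrable a P) (g : E →ᵇ ℝ) :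
    Tendsto (fun n => ∫ z, a z.1 * g z.2 ∂(π n : Measure (Ω × E))) atTop
      (𝓝 (∫ z, a z.1 * g z.2 ∂(ρ : Measure (Ω × E)))) := by
  -- The error of replacing `a` by `b` depends on `σ` only through its first marginal, hence is
  -- uniform along the sequence.
  have bound : ∀ (b : Ω →ᵇ ℝ), Integrable b P → ∀ σ : ProbabilityMeasure (Ω × E),
      (σ : Measure (Ω × E)).map Prod.fst = P →
      |∫ z, a z.1 * g z.2 ∂(σ : Measure (Ω × E)) - ∫ z, b z.1 * g z.2 ∂(σ : Measure (Ω × E))| ≤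
        (∫ ω, ‖a ω - b ω‖ ∂P) * ‖g‖ := by
    intro b hb σ hσ
    have hfst : ∀ {f : Ω → ℝ}, Integrable f P →
        Integrable (fun z : Ω × E => f z.1) (σ : Measure (Ω × E)) := fun {f} hf => by
      rw [← hσ] at hf
      exact (integrable_map_measure hf.aestronglyMeasurable measurable_fst.aemeasurable).1 hf
    have hmul : ∀ {f : Ω → ℝ}, Integrable f P →
        Integrable (fun z : Ω × E => f z.1 * g z.2) (σ : Measure (Ω × E)) := fun {f} hf =>
      (hfst hf).mul_bdd (c := ‖g‖)
        (g.continuous.measurable.comp measurable_snd).aestronglyMeasurable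
        (ae_of_all _ fun z => g.norm_coe_le_norm _)
    rw [← integral_sub (hmul ha) (hmul hb)]
    calc _ ≤ ∫ z, ‖a z.1 * g z.2 - b z.1 * g z.2‖ ∂(σ : Measure (Ω × E)) :=
          norm_integral_le_integral_norm _
      _ ≤ ∫ z, ‖a z.1 - b z.1‖ * ‖g‖ ∂(σ : Measure (Ω × E)) := by
          refine integral_mono ((hmul ha).sub (hmul hb)).norm
            ((hfst (ha.sub hb)).norm.mul_const _) fun z => ?_
          simp only
          rw [← sub_mul, norm_mul]
          gcongr
          exact g.norm_coe_le_norm _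
      _ = _ := by
          rw [integral_mul_const, ← hσ, integral_map measurable_fst.aemeasurable]
          rw [hσ]
          exact (ha.sub hb).norm.aestronglyMeasurable
  rw [Metric.tendsto_atTop]
  intro ε hε
  -- The `+ 1` covers `g = 0`.
  obtain ⟨b, hab, hb⟩ := ha.exists_boundedContinuous_integral_sub_le
    (ε := ε / (3 * (‖g‖ + 1))) (by positivity)
  have hsmall : (∫ ω, ‖a ω - b ω‖ ∂P) * ‖g‖ ≤ ε / 3 := by
    calc _ ≤ ε / (3 * (‖g‖ + 1)) * (‖g‖ + 1) := by gcongr; linarith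
      _ = ε / 3 := by field_simp
  let F : (Ω × E) →ᵇ ℝ :=
    b.compContinuous ⟨Prod.fst, continuous_fst⟩ * g.compContinuous ⟨Prod.snd, continuous_snd⟩
  obtain ⟨n₀, hn₀⟩ := Metric.tendsto_atTop.1
    (ProbabilityMeasure.tendsto_iff_forall_integral_tendsto.1 hlim F) (ε / 3) (by positivity)
  refine ⟨n₀, fun n hn => ?_⟩
  have h1 := (bound b hb (π n) (hπ n)).trans hsmall
  have h2 := (bound b hb ρ hρ).trans hsmall
  have h3 : |∫ z, b z.1 * g z.2 ∂(π n : Measure (Ω × E)) -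
      ∫ z, b z.1 * g z.2 ∂(ρ : Measure (Ω × E))| < ε / 3 := hn₀ n hn
  rw [Real.dist_eq]
  rw [abs_le] at h1 h2
  rw [abs_lt] at h3 ⊢
  constructor <;> linarith [h1.1, h1.2, h2.1, h2.2, h3.1, h3.2]

/-- Sequential compactness of couplings with fixed first and convergent second marginals. -/
theorem exists_tendsto_coupling_subseq_of_continuous {Ω S E : Type*}
    [TopologicalSpace Ω] [PolishSpace Ω] [MeasurableSpace Ω] [BorelSpace Ω]
    [TopologicalSpace S]
    [TopologicalSpace E] [PolishSpace E] [MeasurableSpace E] [BorelSpace E]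
    {P : Measure Ω} [IsProbabilityMeasure P] {X : Ω → S} (hX : Continuous X)
    {π : ℕ → ProbabilityMeasure (Ω × E)} {μs : ℕ → ProbabilityMeasure E} {μ : ProbabilityMeasure E}
    (hfst : ∀ n, (π n : Measure (Ω × E)).map Prod.fst = P)
    (hsnd : ∀ n, (π n : Measure (Ω × E)).map Prod.snd = μs n) (hμ : Tendsto μs atTop (𝓝 μ)) :
    ∃ φ : ℕ → ℕ, StrictMono φ ∧ ∃ ρ : ProbabilityMeasure (Ω × E),
      (ρ : Measure (Ω × E)).map Prod.fst = P ∧ (ρ : Measure (Ω × E)).map Prod.snd = μ ∧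
      (∀ a : Ω → ℝ, Integrable a P → ∀ g : E →ᵇ ℝ,
        Tendsto (fun n => ∫ z, a z.1 * g z.2 ∂(π (φ n) : Measure (Ω × E))) atTop
          (𝓝 (∫ z, a z.1 * g z.2 ∂(ρ : Measure (Ω × E))))) ∧
      ∀ c : S × E → ℝ, LowerSemicontinuous c → 0 ≤ c →
        ∫⁻ z, ENNReal.ofReal (c (X z.1, z.2)) ∂(ρ : Measure (Ω × E)) ≤
          atTop.liminf fun n =>
            ∫⁻ z, ENNReal.ofReal (c (X z.1, z.2)) ∂(π (φ n) : Measure (Ω × E)) := by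
  have htight : IsTightMeasureSet
      {((σ : ProbabilityMeasure (Ω × E)) : Measure (Ω × E)) | σ ∈ Set.range π} := by
    refine IsTightMeasureSet.prodMk ?_ ?_
    · refine (isTightMeasureSet_singleton (μ := P)).subset ?_
      rintro _ ⟨_, ⟨_, ⟨n, rfl⟩, rfl⟩, rfl⟩
      exact hfst n
    · let := TopologicalSpace.upgradeIsCompletelyMetrizable E
      have hc : IsCompact (closure (Set.range μs)) :=
        hμ.isCompact_insert_range.closure_of_subset (Set.subset_insert _ _)
      refine (isTightMeasureSet_of_isCompact_closure hc).subset ?_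
      rintro _ ⟨_, ⟨_, ⟨n, rfl⟩, rfl⟩, rfl⟩
      exact ⟨μs n, ⟨n, rfl⟩, (hsnd n).symm⟩
  obtain ⟨ρ, -, φ, hφ, hlim⟩ := (isCompact_closure_of_isTightMeasureSet htight).tendsto_subseq
    (x := π) fun n => subset_closure ⟨n, rfl⟩
  have hρ1 : (ρ : Measure (Ω × E)).map Prod.fst = P := by
    have h1 := ProbabilityMeasure.tendsto_map_of_tendsto_of_continuous _ _ hlim
      (f := Prod.fst) continuous_fst
    have h2 : ∀ n, ((π ∘ φ) n).map (f := Prod.fst) continuous_fst.aemeasurable =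
        (⟨P, inferInstance⟩ : ProbabilityMeasure Ω) := fun n => Subtype.ext (hfst _)
    simp only [h2] at h1
    have h3 := tendsto_nhds_unique h1 tendsto_const_nhds
    exact congrArg ProbabilityMeasure.toMeasure h3
  have hρ2 : (ρ : Measure (Ω × E)).map Prod.snd = μ := by
    have h1 := ProbabilityMeasure.tendsto_map_of_tendsto_of_continuous _ _ hlim
      (f := Prod.snd) continuous_snd
    have h2 : ∀ n, ((π ∘ φ) n).map (f := Prod.snd) continuous_snd.aemeasurable = μs (φ n) :=
      fun n => Subtype.ext (hsnd _)
    simp only [h2] at h1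
    have h3 := tendsto_nhds_unique h1 (hμ.comp hφ.tendsto_atTop)
    exact congrArg ProbabilityMeasure.toMeasure h3
  refine ⟨φ, hφ, ρ, hρ1, hρ2, fun a ha g =>
    tendsto_integral_mul_of_map_fst_eq (fun n => hfst (φ n)) hρ1 hlim ha g, fun c hc h0 => ?_⟩
  exact (hc.comp (hX.prodMap continuous_id)).lintegral_ofReal_le_liminf (fun z => h0 _) hlim

/-- Sequential compactness of couplings with fixed first and convergent second marginals, tested
against functions that need only be measurable in the first variable. -/
theorem exists_tendsto_coupling_subseq {Ω S E : Type*}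
    [tΩ : TopologicalSpace Ω] [PolishSpace Ω] [mΩ : MeasurableSpace Ω] [BorelSpace Ω]
    [TopologicalSpace S] [SecondCountableTopology S] [MeasurableSpace S] [OpensMeasurableSpace S]
    [TopologicalSpace E] [PolishSpace E] [MeasurableSpace E] [BorelSpace E]
    {P : Measure Ω} [IsProbabilityMeasure P] {X : Ω → S} (hX : Measurable X)
    {π : ℕ → ProbabilityMeasure (Ω × E)} {μs : ℕ → ProbabilityMeasure E} {μ : ProbabilityMeasure E}
    (hfst : ∀ n, (π n : Measure (Ω × E)).map Prod.fst = P)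
    (hsnd : ∀ n, (π n : Measure (Ω × E)).map Prod.snd = μs n) (hμ : Tendsto μs atTop (𝓝 μ)) :
    ∃ φ : ℕ → ℕ, StrictMono φ ∧ ∃ ρ : ProbabilityMeasure (Ω × E),
      (ρ : Measure (Ω × E)).map Prod.fst = P ∧ (ρ : Measure (Ω × E)).map Prod.snd = μ ∧
      (∀ a : Ω → ℝ, Integrable a P → ∀ g : E →ᵇ ℝ,
        Tendsto (fun n => ∫ z, a z.1 * g z.2 ∂(π (φ n) : Measure (Ω × E))) atTop
          (𝓝 (∫ z, a z.1 * g z.2 ∂(ρ : Measure (Ω × E))))) ∧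
      ∀ c : S × E → ℝ, LowerSemicontinuous c → 0 ≤ c →
        ∫⁻ z, ENNReal.ofReal (c (X z.1, z.2)) ∂(ρ : Measure (Ω × E)) ≤
          atTop.liminf fun n =>
            ∫⁻ z, ENNReal.ofReal (c (X z.1, z.2)) ∂(π (φ n) : Measure (Ω × E)) := by
  -- Refine the topology of `Ω` to a Polish one with the same Borel sets in which `X` is continuous.
  -- The conclusion does not mention the topology of `Ω`, so the continuous case applies verbatim.
  obtain ⟨t', hle, hcont, hpol⟩ := hX.exists_continuous
  have hborel : @BorelSpace Ω t' mΩ := by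
    refine @BorelSpace.mk Ω t' mΩ ?_
    rw [borel_eq_borel_of_le hpol ‹@PolishSpace Ω tΩ› hle]
    exact ‹@BorelSpace Ω tΩ mΩ›.measurable_eq
  exact @exists_tendsto_coupling_subseq_of_continuous Ω S E t' hpol mΩ hborel _ _ _ _ _ P _ X hcont
    π μs μ hfst hsnd hμ

/-- The identity `σ(A × r⁻¹B) = ∫ p 1_{r⁻¹B} dσ` for all measurable `B` can be tested with bounded
continuous functions. -/
theorem forall_measureReal_prod_eq_iff {Ω E G : Type*} [MeasurableSpace Ω] [MeasurableSpace E]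
    [MeasurableSpace G] [TopologicalSpace G] [HasOuterApproxClosed G] [BorelSpace G]
    {σ : Measure (Ω × E)} [IsProbabilityMeasure σ] {A : Set Ω} (hA : MeasurableSet A)
    {p : Ω → ℝ} (hp : Measurable p) (hpi : Integrable p (σ.map Prod.fst))
    (hp0 : 0 ≤ᵐ[σ.map Prod.fst] p) {r : E → G} (hr : Measurable r) :
    (∀ B, MeasurableSet B →
        σ.real (A ×ˢ (r ⁻¹' B)) = ∫ z in Prod.snd ⁻¹' (r ⁻¹' B), p z.1 ∂σ) ↔
      ∀ g : G →ᵇ ℝ, ∫ z, (A.indicator (fun _ => (1 : ℝ)) z.1 - p z.1) * g (r z.2) ∂σ = 0 := by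
  have hpi' : Integrable (fun z : Ω × E => p z.1) σ :=
    (integrable_map_measure hpi.aestronglyMeasurable measurable_fst.aemeasurable).1 hpi
  have hp0' : 0 ≤ᵐ[σ] fun z => p z.1 := ae_of_ae_map measurable_fst.aemeasurable hp0
  have hrs : Measurable fun z : Ω × E => r z.2 := hr.comp measurable_snd
  have hA' : MeasurableSet ((Prod.fst : Ω × E → Ω) ⁻¹' A) := measurable_fst hA
  -- Both sides, as functions of `B`, are finite measures on `G`: the images under `r` of `σ`
  -- restricted to `A` and of `p σ`. Finite measures are determined by bounded continuous functions.
  set κ := σ.withDensity fun z => ENNReal.ofReal (p z.1) with hκ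
  have hκf : IsFiniteMeasure κ := isFiniteMeasure_withDensity_ofReal hpi'.2
  have e1 : ∀ B, MeasurableSet B → ((σ.restrict (Prod.fst ⁻¹' A)).map fun z => r z.2) B =
      ENNReal.ofReal (σ.real (A ×ˢ (r ⁻¹' B))) := by
    intro B hB
    rw [Measure.map_apply hrs hB, Measure.restrict_apply (hrs hB), ofReal_measureReal,
      Set.inter_comm, Set.prod_eq]
    rfl
  have e2 : ∀ B, MeasurableSet B → (κ.map fun z => r z.2) B =
      ENNReal.ofReal (∫ z in Prod.snd ⁻¹' (r ⁻¹' B), p z.1 ∂σ) := by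
    intro B hB
    rw [Measure.map_apply hrs hB, hκ, withDensity_apply _ (hrs hB),
      ofReal_integral_eq_lintegral_ofReal hpi'.integrableOn (ae_restrict_of_ae hp0')]
    rfl
  have hsets : (∀ B, MeasurableSet B →
      σ.real (A ×ˢ (r ⁻¹' B)) = ∫ z in Prod.snd ⁻¹' (r ⁻¹' B), p z.1 ∂σ) ↔
      ((σ.restrict (Prod.fst ⁻¹' A)).map fun z => r z.2) = κ.map fun z => r z.2 := by
    refine ⟨fun h => Measure.ext fun B hB => by rw [e1 B hB, e2 B hB, h B hB], fun h B hB => ?_⟩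
    have := congrArg (fun ν => ν B) h
    simp only [e1 B hB, e2 B hB] at this
    exact (ENNReal.ofReal_eq_ofReal_iff measureReal_nonneg
      (integral_nonneg_of_ae (ae_restrict_of_ae hp0'))).1 this
  have hgm : ∀ g : G →ᵇ ℝ, Measurable fun z : Ω × E => g (r z.2) := fun g =>
    g.continuous.measurable.comp hrs
  have hint : ∀ g : G →ᵇ ℝ,
      ∫ z, (A.indicator (fun _ => (1 : ℝ)) z.1 - p z.1) * g (r z.2) ∂σ =
        ∫ y, g y ∂((σ.restrict (Prod.fst ⁻¹' A)).map fun z => r z.2) -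
          ∫ y, g y ∂(κ.map fun z => r z.2) := by
    intro g
    have hgb : ∀ᵐ z ∂σ, ‖g (r z.2)‖ ≤ ‖g‖ := ae_of_all _ fun z => g.norm_coe_le_norm _
    have hAi : Integrable (fun z : Ω × E => A.indicator (fun _ => (1 : ℝ)) z.1) σ :=
      (integrable_const (1 : ℝ)).indicator hA'
    have hpm : Measurable fun z : Ω × E => ENNReal.ofReal (p z.1) :=
      (hp.comp measurable_fst).ennreal_ofReal
    rw [integral_map hrs.aemeasurable g.continuous.measurable.aestronglyMeasurable,
      integral_map hrs.aemeasurable g.continuous.measurable.aestronglyMeasurable, hκ,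
      integral_withDensity_eq_integral_toReal_smul hpm
        (ae_of_all _ fun _ => ENNReal.ofReal_lt_top), ← integral_indicator hA']
    simp_rw [sub_mul]
    rw [integral_sub (hAi.mul_bdd (hgm g).aestronglyMeasurable hgb)
      (hpi'.mul_bdd (hgm g).aestronglyMeasurable hgb)]
    congr 1
    · refine integral_congr_ae (ae_of_all _ fun z => ?_)
      by_cases hz : z.1 ∈ A <;> simp [Set.indicator, hz]
    · refine integral_congr_ae ?_
      filter_upwards [hp0'] with z hz
      rw [ENNReal.toReal_ofReal hz, smul_eq_mul]
  rw [hsets]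
  refine ⟨fun h g => by rw [hint, h, sub_self], fun h =>
    ext_of_forall_integral_eq_of_IsFiniteMeasure fun g => ?_⟩
  rw [← sub_eq_zero, ← hint, h]

/-! ### Causal couplings and reduction to canonical processes -/

section Causal

variable {T : ℕ} {S : Fin T → Type u} {R : Fin T → Type v}
  [∀ t, MeasurableSpace (S t)]

theorem FilteredProcess.measurable_proc (𝕏 : FilteredProcess.{u, w} S) : Measurable 𝕏.proc :=
  measurable_pi_iff.2 fun t => (𝕏.adapted t).mono (Filtration.le _ t) le_rfl

/-- A causal coupling, in terms of the conditional probabilities under `P^𝕏`. -/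
theorem isCausalCoupling_iff [∀ t, MeasurableSpace (R t)] (𝕏 : FilteredProcess.{u, w} S)
    (𝕐 : FilteredProcess.{v, v} R) (π : ProbabilityMeasure ((∀ t, 𝕏.Ω t) × (∀ t, 𝕐.Ω t))) :
    IsCausalCoupling 𝕏 𝕐 π ↔
      (π : Measure ((∀ t, 𝕏.Ω t) × (∀ t, 𝕐.Ω t))).map Prod.fst = 𝕏.P ∧
      (π : Measure ((∀ t, 𝕏.Ω t) × (∀ t, 𝕐.Ω t))).map Prod.snd = 𝕐.P ∧
      ∀ (t : Fin T) (A : Set (∀ t, 𝕏.Ω t)) (B : Set (∀ t, 𝕐.Ω t)), MeasurableSet A →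
        MeasurableSet[Filtration.piLE (X := 𝕐.Ω) t] B →
        (π : Measure ((∀ t, 𝕏.Ω t) × (∀ t, 𝕐.Ω t))).real (A ×ˢ B) =
          ∫ z in Prod.snd ⁻¹' B, (𝕏.P⟦A | Filtration.piLE (X := 𝕏.Ω) t⟧) z.1
            ∂(π : Measure ((∀ t, 𝕏.Ω t) × (∀ t, 𝕐.Ω t))) := by
  constructor
  · rintro ⟨h1, h2, h3⟩
    refine ⟨h1, h2, fun t => ?_⟩
    have := (condIndep_comap_iff (Filtration.le _ t) (Filtration.le _ t) _ _).1 (h3 t)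
    rwa [h1] at this
  · rintro ⟨h1, h2, h3⟩
    refine ⟨h1, h2, fun t => ?_⟩
    refine (condIndep_comap_iff (Filtration.le _ t) (Filtration.le _ t) _ _).2 ?_
    rw [h1]
    exact h3 t

variable [∀ t, TopologicalSpace (R t)] [∀ t, PolishSpace (R t)] [∀ t, MeasurableSpace (R t)]
  [∀ t, BorelSpace (R t)]

/-- The law of a filtered process on the path space. -/
noncomputable def FilteredProcess.law (𝕐 : FilteredProcess.{v, w} R) :
    ProbabilityMeasure (∀ t, R t) :=
  ⟨𝕐.P.map 𝕐.proc, Measure.isProbabilityMeasure_map 𝕐.measurable_proc.aemeasurable⟩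

/-- Events up to `t` are preimages under restriction to times `≤ t`, a continuous map. This form
lets causality be tested with continuous functions of the restricted path. -/
theorem isCausalCoupling_canonical_iff (𝕏 : FilteredProcess.{u, w} S)
    (μ : ProbabilityMeasure (∀ t, R t)) (π : ProbabilityMeasure ((∀ t, 𝕏.Ω t) × (∀ t, R t))) :
    IsCausalCoupling 𝕏 (FilteredProcess.canonical μ) π ↔
      (π : Measure ((∀ t, 𝕏.Ω t) × (∀ t, R t))).map Prod.fst = 𝕏.P ∧
      (π : Measure ((∀ t, 𝕏.Ω t) × (∀ t, R t))).map Prod.snd = μ ∧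
      ∀ (t : Fin T) (A : Set (∀ t, 𝕏.Ω t)), MeasurableSet A →
        ∀ B : Set (∀ s : Set.Iic t, R s), MeasurableSet B →
        (π : Measure ((∀ t, 𝕏.Ω t) × (∀ t, R t))).real
            (A ×ˢ (Preorder.restrictLe (π := R) t ⁻¹' B)) =
          ∫ z in Prod.snd ⁻¹' (Preorder.restrictLe (π := R) t ⁻¹' B),
            (𝕏.P⟦A | Filtration.piLE (X := 𝕏.Ω) t⟧) z.1
            ∂(π : Measure ((∀ t, 𝕏.Ω t) × (∀ t, R t))) := by
  refine (isCausalCoupling_iff 𝕏 (FilteredProcess.canonical μ) π).trans ⟨?_, ?_⟩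
  · rintro ⟨h1, h2, h3⟩
    exact ⟨h1, h2, fun t A hA B hB => h3 t A _ hA ⟨B, hB, rfl⟩⟩
  · rintro ⟨h1, h2, h3⟩
    refine ⟨h1, h2, ?_⟩
    rintro t A _ hA ⟨B, hB, rfl⟩
    exact h3 t A hA B hB

/-- By adaptedness, an event of the path of `Y` up to `t` pulls back to an event of `F^𝕐_t`. The
conditioning involves `𝕏` only, so passing to the smaller filtration generated by `Y` keeps
causality. -/
theorem IsCausalCoupling.map_canonical {𝕏 : FilteredProcess.{u, w} S}
    {𝕐 : FilteredProcess.{v, v} R} {π : ProbabilityMeasure ((∀ t, 𝕏.Ω t) × (∀ t, 𝕐.Ω t))}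
    (h : IsCausalCoupling 𝕏 𝕐 π) :
    IsCausalCoupling 𝕏 (FilteredProcess.canonical 𝕐.law)
      (π.map (f := Prod.map id 𝕐.proc)
        (measurable_id.prodMap 𝕐.measurable_proc).aemeasurable) := by
  have hm : Measurable (Prod.map (id : (∀ t, 𝕏.Ω t) → _) 𝕐.proc) :=
    measurable_id.prodMap 𝕐.measurable_proc
  obtain ⟨h1, h2, h3⟩ := (isCausalCoupling_iff _ _ _).1 h
  let σ : ProbabilityMeasure ((∀ t, 𝕏.Ω t) × (∀ t, R t)) := π.map hm.aemeasurable
  have hσ : (σ : Measure ((∀ t, 𝕏.Ω t) × (∀ t, R t))) =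
      (π : Measure _).map (Prod.map id 𝕐.proc) := rfl
  refine (isCausalCoupling_canonical_iff 𝕏 𝕐.law σ).2 ⟨?_, ?_, fun t A hA B hB => ?_⟩
  · rw [hσ, Measure.map_map measurable_fst hm]
    exact h1
  · rw [hσ, Measure.map_map measurable_snd hm]
    change _ = 𝕐.P.map 𝕐.proc
    rw [← h2, Measure.map_map 𝕐.measurable_proc measurable_snd]
    rfl
  · have hr : Measurable (Preorder.restrictLe (π := R) t) :=
      measurable_pi_iff.2 fun s => measurable_pi_apply _
    have hB' : MeasurableSet[Filtration.piLE (X := 𝕐.Ω) t]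
        (𝕐.proc ⁻¹' (Preorder.restrictLe (π := R) t ⁻¹' B)) := by
      have : Measurable[Filtration.piLE (X := 𝕐.Ω) t]
          (fun ω => Preorder.restrictLe (π := R) t (𝕐.proc ω)) :=
        (@measurable_pi_iff _ _ _ (Filtration.piLE (X := 𝕐.Ω) t) _ _).2 fun s =>
          (𝕐.adapted s).mono ((Filtration.piLE (X := 𝕐.Ω)).mono s.2) le_rfl
      exact this hB
    have hset : MeasurableSet (A ×ˢ (Preorder.restrictLe (π := R) t ⁻¹' B)) := hA.prod (hr hB)
    have key := h3 t A _ hA hB'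
    rw [hσ, Measure.real, Measure.map_apply hm hset,
      setIntegral_map (measurable_snd (hr hB)) ?_ hm.aemeasurable]
    · exact key
    · exact ((stronglyMeasurable_condExp.mono (Filtration.le _ t)).comp_measurable
        measurable_fst).aestronglyMeasurable

end Causal

/-! ### Shifting to nonnegative costs -/

theorem EReal.coe_ennreal_add_coe_le_iff {x y : ℝ≥0∞} (b : ℝ) :
    (x : EReal) + b ≤ y + b ↔ x ≤ y := by
  rw [(EReal.addLECancellable_coe b).add_le_add_iff_right, EReal.coe_ennreal_le_coe_ennreal_iff]

/-- Adding a finite constant is monotone and continuous, and fixes `⊤`, which settles the infimum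
over an empty family. -/
theorem EReal.coe_ennreal_iInf_add_coe {ι : Sort*} (f : ι → ℝ≥0∞) (b : ℝ) :
    ((⨅ i, f i : ℝ≥0∞) : EReal) + b = ⨅ i, ((f i : EReal) + b) := by
  have hcont : Continuous fun x : ℝ≥0∞ => (x : EReal) + b := by
    rw [continuous_iff_continuousAt]
    intro x
    exact ContinuousAt.comp (f := fun x : ℝ≥0∞ => ((x : EReal), (b : EReal)))
      (EReal.continuousAt_add (Or.inr (EReal.coe_ne_bot b)) (Or.inr (EReal.coe_ne_top b)))
      ((continuous_coe_ennreal_ereal.continuousAt).prodMk continuousAt_const)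
  refine Monotone.map_iInf_of_continuousAt (f := fun x : ℝ≥0∞ => (x : EReal) + b)
    hcont.continuousAt (fun x y h => (EReal.coe_ennreal_add_coe_le_iff b).2 h) ?_
  simp

/-- The extended expectation of a function bounded below by `b`. -/
theorem erealExpectation_eq_add {Ω : Type*} [MeasurableSpace Ω] (μ : Measure Ω)
    [IsProbabilityMeasure μ] {f : Ω → ℝ} (hf : Measurable f) {b : ℝ} (hb : ∀ ω, b ≤ f ω) :
    erealExpectation μ f = ((∫⁻ ω, ENNReal.ofReal (f ω - b) ∂μ : ℝ≥0∞) : EReal) + b := by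
  -- This integrates `f⁺ + b⁻ = (f - b) + f⁻ + b⁺`, arranged without subtraction so that it makes
  -- sense for infinite integrals.
  have hsum : (∫⁻ ω, ENNReal.ofReal (f ω) ∂μ) + ENNReal.ofReal (-b) =
      (∫⁻ ω, ENNReal.ofReal (f ω - b) ∂μ) + (∫⁻ ω, ENNReal.ofReal (-f ω) ∂μ) +
        ENNReal.ofReal b := by
    have e : ∀ a : ℝ, ENNReal.ofReal a = ∫⁻ _, ENNReal.ofReal a ∂μ := fun a => by simp
    have hfn : Measurable fun ω => ENNReal.ofReal (-f ω) := hf.neg.ennreal_ofReal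
    rw [e (-b), e b, ← lintegral_add_right _ measurable_const, ← lintegral_add_right _ hfn,
      ← lintegral_add_right _ measurable_const]
    refine lintegral_congr fun ω => ?_
    have h1 := hb ω
    have hof : ∀ a : ℝ, ENNReal.ofReal a = ENNReal.ofReal (max a 0) := fun a => by
      rcases le_total a 0 with h | h
      · rw [max_eq_right h, ENNReal.ofReal_of_nonpos h, ENNReal.ofReal_zero]
      · rw [max_eq_left h]
    rw [hof (f ω), hof (-b), hof (-f ω), hof b, ← ENNReal.ofReal_add (by positivity) (by positivity),
      ← ENNReal.ofReal_add (by linarith) (by positivity),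
      ← ENNReal.ofReal_add (by positivity) (by positivity)]
    congr 1
    have : ∀ a : ℝ, max a 0 - max (-a) 0 = a := fun a => by
      rcases le_total a 0 with h | h
      · rw [max_eq_right h, max_eq_left (by linarith)]; ring
      · rw [max_eq_left h, max_eq_right (by linarith)]; ring
    linarith [this (f ω), this b]
  -- The negative part has finite integral, so the integrals of `f⁺` and `f - b` can only be
  -- infinite together.
  have hneg : ∫⁻ ω, ENNReal.ofReal (-f ω) ∂μ ≤ ENNReal.ofReal (-b) :=
    (lintegral_mono fun ω => ENNReal.ofReal_le_ofReal (neg_le_neg (hb ω))).trans (by simp)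
  rw [erealExpectation]
  generalize ∫⁻ ω, ENNReal.ofReal (f ω) ∂μ = p at *
  generalize ∫⁻ ω, ENNReal.ofReal (-f ω) ∂μ = n at *
  generalize ∫⁻ ω, ENNReal.ofReal (f ω - b) ∂μ = q at *
  lift n to NNReal using ne_top_of_le_ne_top ENNReal.ofReal_ne_top hneg
  rcases eq_or_ne q ⊤ with rfl | hq
  · have hp : p = ⊤ := by
      by_contra h
      have := ENNReal.add_ne_top.2 ⟨h, ENNReal.ofReal_ne_top (r := -b)⟩
      rw [hsum] at this
      simp at this
    subst hp
    rw [EReal.coe_ennreal_top, EReal.top_add_coe]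
    exact EReal.top_sub_coe _
  · have hp : p ≠ ⊤ := by
      rintro rfl
      have := ENNReal.add_ne_top.2 ⟨ENNReal.add_ne_top.2 ⟨hq, ENNReal.coe_ne_top (r := n)⟩,
        ENNReal.ofReal_ne_top (r := b)⟩
      rw [← hsum] at this
      simp at this
    lift p to NNReal using hp
    lift q to NNReal using hq
    have hsum' : (p : ℝ) + max (-b) 0 = q + n + max b 0 := by
      have := congrArg ENNReal.toReal hsum
      rw [ENNReal.toReal_add (by simp) (by simp), ENNReal.toReal_add (by simp) (by simp),
        ENNReal.toReal_add (by simp) (by simp), ENNReal.toReal_ofReal', ENNReal.toReal_ofReal']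
        at this
      simpa using this
    have hb' : max b 0 - max (-b) 0 = b := by
      rcases le_total b 0 with h | h
      · rw [max_eq_right h, max_eq_left (by linarith)]; ring
      · rw [max_eq_left h, max_eq_right (by linarith)]; ring
    change ((p : ℝ) : EReal) - ((n : ℝ) : EReal) = ((q : ℝ) : EReal) + b
    rw [← EReal.coe_sub, ← EReal.coe_add]
    congr 1
    linarith

section Causal

variable {T : ℕ} {S : Fin T → Type u} {R : Fin T → Type v}
  [∀ t, MeasurableSpace (S t)]

/-- The causal transport value of the positive part of a cost, as an extended nonnegative real. -/
noncomputable def causalValueENNReal [∀ t, MeasurableSpace (R t)]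
    (c : (∀ t, S t) × (∀ t, R t) → ℝ) (𝕏 : FilteredProcess.{u, w} S)
    (𝕐 : FilteredProcess.{v, v} R) : ℝ≥0∞ :=
  ⨅ (π : ProbabilityMeasure ((∀ t, 𝕏.Ω t) × (∀ t, 𝕐.Ω t))) (_ : IsCausalCoupling 𝕏 𝕐 π),
    ∫⁻ ω, ENNReal.ofReal (c (𝕏.proc ω.1, 𝕐.proc ω.2))
      ∂(π : Measure ((∀ t, 𝕏.Ω t) × (∀ t, 𝕐.Ω t)))

theorem causalValue_eq_add [∀ t, MeasurableSpace (R t)] {c : (∀ t, S t) × (∀ t, R t) → ℝ}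
    (hc : Measurable c) {b : ℝ} (hb : ∀ p, b ≤ c p) (𝕏 : FilteredProcess.{u, w} S)
    (𝕐 : FilteredProcess.{v, v} R) :
    causalValue c 𝕏 𝕐 = (causalValueENNReal (fun p => c p - b) 𝕏 𝕐 : EReal) + b := by
  rw [causalValueENNReal, EReal.coe_ennreal_iInf_add_coe, causalValue]
  refine iInf_congr fun π => ?_
  rw [EReal.coe_ennreal_iInf_add_coe]
  refine iInf_congr fun _ => ?_
  exact erealExpectation_eq_add _
    (hc.comp ((𝕏.measurable_proc.comp measurable_fst).prodMk
      (𝕐.measurable_proc.comp measurable_snd))) fun ω => hb _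

theorem causalBaryFunctional_eq_add [∀ t, MeasurableSpace (R t)] {N : ℕ}
    {c : Fin N → (∀ t, S t) × (∀ t, R t) → ℝ}
    (hc : ∀ i, Measurable (c i)) {b : Fin N → ℝ} (hb : ∀ i p, b i ≤ c i p)
    (𝕏 : Fin N → FilteredProcess.{u, w} S) (𝕐 : FilteredProcess.{v, v} R) :
    causalBaryFunctional c 𝕏 𝕐 =
      ((∑ i, causalValueENNReal (fun p => c i p - b i) (𝕏 i) 𝕐 : ℝ≥0∞) : EReal) +
        ((∑ i, b i : ℝ) : EReal) := by
  rw [causalBaryFunctional, Finset.sum_congr rfl fun i _ => causalValue_eq_add (hc i) (hb i) _ _,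
    Finset.sum_add_distrib]
  congr 1
  · exact (map_sum (⟨⟨fun x : ℝ≥0∞ => (x : EReal), EReal.coe_ennreal_zero⟩,
      EReal.coe_ennreal_add⟩ : ℝ≥0∞ →+ EReal) _ _).symm
  · exact (map_sum (⟨⟨fun x : ℝ => (x : EReal), EReal.coe_zero⟩,
      EReal.coe_add⟩ : ℝ →+ EReal) _ _).symm

/-- The lower bounds `b i` add the same finite constant for every competitor, so minimality can be
read off in `ℝ≥0∞`. -/
theorem isCausalBarycenter_iff [∀ t, MeasurableSpace (R t)] {N : ℕ}
    {c : Fin N → (∀ t, S t) × (∀ t, R t) → ℝ}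
    (hc : ∀ i, Measurable (c i)) {b : Fin N → ℝ} (hb : ∀ i p, b i ≤ c i p)
    (𝕏 : Fin N → FilteredProcess.{u, w} S) (𝕐 : FilteredProcess.{v, v} R) :
    IsCausalBarycenter c 𝕏 𝕐 ↔ ∀ 𝕐' : FilteredProcess.{v, v} R,
      ∑ i, causalValueENNReal (fun p => c i p - b i) (𝕏 i) 𝕐 ≤
        ∑ i, causalValueENNReal (fun p => c i p - b i) (𝕏 i) 𝕐' := by
  have h : IsCausalBarycenter c 𝕏 𝕐 ↔
      ∀ 𝕐', causalBaryFunctional c 𝕏 𝕐 ≤ causalBaryFunctional c 𝕏 𝕐' :=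
    ⟨fun h 𝕐' => h.le.trans (iInf_le _ _), fun h => le_antisymm (le_iInf h) (iInf_le _ _)⟩
  rw [h]
  refine forall_congr' fun 𝕐' => ?_
  rw [causalBaryFunctional_eq_add hc hb, causalBaryFunctional_eq_add hc hb,
    EReal.coe_ennreal_add_coe_le_iff]

/-! ### Lower semicontinuity in the law -/

section Canonical

variable [∀ t, TopologicalSpace (R t)] [∀ t, PolishSpace (R t)] [∀ t, MeasurableSpace (R t)]
  [∀ t, BorelSpace (R t)]

theorem causalValueENNReal_canonical_law_le (c : (∀ t, S t) × (∀ t, R t) → ℝ)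
    (𝕏 : FilteredProcess.{u, w} S) (𝕐 : FilteredProcess.{v, v} R) :
    causalValueENNReal c 𝕏 (FilteredProcess.canonical 𝕐.law) ≤ causalValueENNReal c 𝕏 𝕐 :=
  le_iInf₂ fun _ hπ => iInf₂_le_of_le _ hπ.map_canonical (lintegral_map_le _ _)

/-- The causal transport value is lower semicontinuous in the law of the second process. -/
theorem lowerSemicontinuous_causalValueENNReal_canonical
    [∀ t, TopologicalSpace (S t)] [∀ t, PolishSpace (S t)] [∀ t, BorelSpace (S t)]
    {c : (∀ t, S t) × (∀ t, R t) → ℝ} (hc : LowerSemicontinuous c) (h0 : 0 ≤ c)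
    (𝕏 : FilteredProcess.{u, w} S) :
    LowerSemicontinuous fun μ : ProbabilityMeasure (∀ t, R t) =>
      causalValueENNReal c 𝕏 (FilteredProcess.canonical μ) := by
  rw [lowerSemicontinuous_iff_isClosed_preimage]
  refine fun y => IsSeqClosed.isClosed fun μs μ hs hμ => ?_
  change causalValueENNReal c 𝕏 (FilteredProcess.canonical μ) ≤ y
  -- Working with levels `b > y` allows almost optimal couplings, so attainment of the infimum is
  -- not needed.
  refine le_of_forall_gt_imp_ge_of_dense fun b hb => ?_
  have hex : ∀ n, ∃ π : ProbabilityMeasure ((∀ t, 𝕏.Ω t) × (∀ t, R t)),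
      IsCausalCoupling 𝕏 (FilteredProcess.canonical (μs n)) π ∧
      ∫⁻ ω, ENNReal.ofReal (c (𝕏.proc ω.1, ω.2))
        ∂(π : Measure ((∀ t, 𝕏.Ω t) × (∀ t, R t))) < b := fun n => by
    obtain ⟨π, h⟩ := iInf_lt_iff.1 (lt_of_le_of_lt (hs n) hb)
    obtain ⟨h1, h2⟩ := iInf_lt_iff.1 h
    exact ⟨π, h1, h2⟩
  choose π hπ hπb using hex
  have hπ' := fun n => (isCausalCoupling_canonical_iff 𝕏 (μs n) (π n)).1 (hπ n)
  obtain ⟨φ, -, ρ, hρ1, hρ2, hρlim, hρc⟩ := exists_tendsto_coupling_subseq 𝕏.measurable_proc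
    (fun n => (hπ' n).1) (fun n => (hπ' n).2.1) hμ
  have hρ : IsCausalCoupling 𝕏 (FilteredProcess.canonical μ) ρ := by
    refine (isCausalCoupling_canonical_iff 𝕏 μ ρ).2 ⟨hρ1, hρ2, fun t A hA => ?_⟩
    have hm := Filtration.le (Filtration.piLE (X := 𝕏.Ω)) t
    set p := 𝕏.P⟦A | Filtration.piLE (X := 𝕏.Ω) t⟧
    have hpm : Measurable p := (stronglyMeasurable_condExp.mono hm).measurable
    have hpi : Integrable p 𝕏.P := integrable_condExp
    have hp0 : 0 ≤ᵐ[𝕏.P] p :=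
      condExp_nonneg (ae_of_all _ fun ω => Set.indicator_nonneg (fun _ _ => zero_le_one) ω)
    have hrc : Continuous (Preorder.restrictLe (π := R) t) :=
      continuous_pi fun s => continuous_apply _
    refine (forall_measureReal_prod_eq_iff hA hpm (by rwa [hρ1]) (by rwa [hρ1])
      hrc.measurable).2 fun g => ?_
    -- The test function is only integrable in `ω`, but continuous in the path. Along the sequence
    -- these integrals vanish by causality, hence also in the limit.
    have hlim := hρlim (fun ω => A.indicator (fun _ => (1 : ℝ)) ω - p ω)
      (((integrable_const _).indicator hA).sub hpi) (g.compContinuous ⟨_, hrc⟩)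
    refine tendsto_nhds_unique hlim ?_
    refine tendsto_const_nhds.congr fun n => Eq.symm ?_
    refine (forall_measureReal_prod_eq_iff hA hpm (by rwa [(hπ' (φ n)).1])
      (by rwa [(hπ' (φ n)).1]) hrc.measurable).1 ?_ g
    exact (hπ' (φ n)).2.2 t A hA
  refine iInf₂_le_of_le ρ hρ ((hρc c hc h0).trans ?_)
  exact liminf_le_of_frequently_le' (Frequently.of_forall fun n => (hπb (φ n)).le)

end Canonical

end Causal

/-! ### Moment bounds and tightness -/

theorem pathDist_nonneg {T : ℕ} {S : Fin T → Type u} [∀ t, MetricSpace (S t)] (y y' : ∀ t, S t) :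
    0 ≤ pathDist y y' :=
  Finset.sum_nonneg fun _ _ => dist_nonneg

theorem pathDist_comm {T : ℕ} {S : Fin T → Type u} [∀ t, MetricSpace (S t)] (y y' : ∀ t, S t) :
    pathDist y y' = pathDist y' y :=
  Finset.sum_congr rfl fun _ _ => dist_comm _ _

theorem continuous_pathDist {T : ℕ} {S : Fin T → Type u} [∀ t, MetricSpace (S t)] (y : ∀ t, S t) :
    Continuous (pathDist y) :=
  continuous_finsetSum _ fun t _ => continuous_const.dist (continuous_apply t)

/-- A set of probability measures whose integrals of a function with relatively compact sublevel
sets are uniformly bounded is tight. -/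
theorem isTightMeasureSet_of_lintegral_le {E : Type*} [TopologicalSpace E] [MeasurableSpace E]
    {f : E → ℝ} (hf : Measurable f) (hK : ∀ K : ℝ, 0 ≤ K → IsCompact {y | f y ≤ K})
    {D : ℝ≥0∞} (hD : D ≠ ⊤) {M : Set (Measure E)}
    (hM : ∀ μ ∈ M, ∫⁻ y, ENNReal.ofReal (f y) ∂μ ≤ D) : IsTightMeasureSet M := by
  rw [isTightMeasureSet_iff_exists_isCompact_measure_compl_le]
  intro ε hε
  -- Markov's inequality is used at level `D / ε + 1`; the `+ 1` keeps the level positive when `D /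
  -- ε = 0`.
  have hr : D / ε + 1 ≠ ⊤ := ENNReal.add_ne_top.2 ⟨(ENNReal.div_lt_top hD hε.ne').ne, by simp⟩
  have hr0 : D / ε + 1 ≠ 0 := by simp
  refine ⟨_, hK (D / ε + 1).toReal ENNReal.toReal_nonneg, fun μ hμ => ?_⟩
  calc μ {y | f y ≤ (D / ε + 1).toReal}ᶜ ≤ μ {y | D / ε + 1 ≤ ENNReal.ofReal (f y)} := by
        refine measure_mono fun y hy => ?_
        simp only [Set.mem_compl_iff, Set.mem_ofPred_eq, not_le] at hy ⊢
        rw [← ENNReal.ofReal_toReal hr]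
        exact ENNReal.ofReal_le_ofReal hy.le
    _ ≤ (∫⁻ y, ENNReal.ofReal (f y) ∂μ) / (D / ε + 1) :=
        meas_ge_le_lintegral_div hf.ennreal_ofReal.aemeasurable hr0 hr
    _ ≤ D / (D / ε + 1) := by gcongr; exact hM μ hμ
    _ ≤ ε := by
        rcases eq_or_ne ε ⊤ with rfl | hε'
        · exact le_top
        refine ENNReal.div_le_of_le_mul ?_
        rw [mul_add, ENNReal.mul_div_cancel hε.ne' hε']
        exact le_self_add

section Causal

variable {T : ℕ} {S : Fin T → Type u} {R : Fin T → Type v}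
  [∀ t, MeasurableSpace (S t)] [∀ t, MetricSpace (R t)] [∀ t, SecondCountableTopology (R t)]
  [∀ t, MeasurableSpace (R t)] [∀ t, BorelSpace (R t)]

/-- A growth condition on the cost turns a bound on the transport value into a moment bound. -/
theorem lintegral_pathDist_le_of_causalValueENNReal_lt {𝕏 : FilteredProcess.{u, w} S}
    {𝕐 : FilteredProcess.{v, v} R} {c : (∀ t, S t) × (∀ t, R t) → ℝ} (hc : Measurable c) {b : ℝ}
    (hb : ∀ p, b ≤ c p) {y₀ : ∀ t, R t} {C : ℝ} (hC : 0 ≤ C) {ℓ : (∀ t, S t) → ℝ}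
    (hℓ : AEMeasurable ℓ (𝕏.P.map 𝕏.proc))
    (h_growth : ∀ x y, pathDist y₀ y ≤ C * (1 + c (x, y) + ℓ x)) {M : ℝ≥0∞}
    (hM : causalValueENNReal (fun p => c p - b) 𝕏 𝕐 < M) :
    ∫⁻ ω, ENNReal.ofReal (pathDist y₀ (𝕐.proc ω)) ∂𝕐.P ≤
      ENNReal.ofReal C * (M + ENNReal.ofReal (1 + |b|) + ∫⁻ x, ‖ℓ x‖ₑ ∂(𝕏.P.map 𝕏.proc)) := by
  obtain ⟨π, h⟩ := iInf_lt_iff.1 hM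
  obtain ⟨hπ, hlt⟩ := iInf_lt_iff.1 h
  have hcm : Measurable fun ω : (∀ t, 𝕏.Ω t) × (∀ t, 𝕐.Ω t) => c (𝕏.proc ω.1, 𝕐.proc ω.2) :=
    hc.comp ((𝕏.measurable_proc.comp measurable_fst).prodMk
      (𝕐.measurable_proc.comp measurable_snd))
  have hd : Measurable fun ω => ENNReal.ofReal (pathDist y₀ (𝕐.proc ω)) :=
    ((continuous_pathDist y₀).measurable.comp 𝕐.measurable_proc).ennreal_ofReal
  have hℓπ : ∫⁻ z, ‖ℓ (𝕏.proc z.1)‖ₑ ∂(π : Measure ((∀ t, 𝕏.Ω t) × (∀ t, 𝕐.Ω t))) =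
      ∫⁻ x, ‖ℓ x‖ₑ ∂(𝕏.P.map 𝕏.proc) := by
    rw [← hπ.map_fst, Measure.map_map 𝕏.measurable_proc measurable_fst] at hℓ ⊢
    rw [lintegral_map' hℓ.enorm (𝕏.measurable_proc.comp measurable_fst).aemeasurable]
    rfl
  rw [← hπ.map_snd, lintegral_map hd measurable_snd, ← hℓπ]
  calc _ ≤ ∫⁻ z, ENNReal.ofReal C * ((ENNReal.ofReal (c (𝕏.proc z.1, 𝕐.proc z.2) - b) +
          ENNReal.ofReal (1 + |b|)) + ‖ℓ (𝕏.proc z.1)‖ₑ)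
          ∂(π : Measure ((∀ t, 𝕏.Ω t) × (∀ t, 𝕐.Ω t))) := by
        refine lintegral_mono fun z => ?_
        have h1 := hb (𝕏.proc z.1, 𝕐.proc z.2)
        rw [Real.enorm_eq_ofReal_abs, ← ENNReal.ofReal_add (sub_nonneg.2 h1) (by positivity),
          ← ENNReal.ofReal_add (add_nonneg (sub_nonneg.2 h1) (by positivity)) (abs_nonneg _),
          ← ENNReal.ofReal_mul hC]
        refine ENNReal.ofReal_le_ofReal ((h_growth (𝕏.proc z.1) _).trans ?_)
        exact mul_le_mul_of_nonneg_left
          (by linarith [le_abs_self b, le_abs_self (ℓ (𝕏.proc z.1))]) hC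
    _ = ENNReal.ofReal C * ((∫⁻ z, ENNReal.ofReal (c (𝕏.proc z.1, 𝕐.proc z.2) - b)
          ∂(π : Measure ((∀ t, 𝕏.Ω t) × (∀ t, 𝕐.Ω t)))) + ENNReal.ofReal (1 + |b|) +
          ∫⁻ z, ‖ℓ (𝕏.proc z.1)‖ₑ ∂(π : Measure ((∀ t, 𝕏.Ω t) × (∀ t, 𝕐.Ω t)))) := by
        have hm1 : Measurable fun z : (∀ t, 𝕏.Ω t) × (∀ t, 𝕐.Ω t) =>
            ENNReal.ofReal (c (𝕏.proc z.1, 𝕐.proc z.2) - b) := (hcm.sub_const b).ennreal_ofReal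
        rw [lintegral_const_mul' _ _ ENNReal.ofReal_ne_top,
          lintegral_add_left (hm1.add_const (ENNReal.ofReal (1 + |b|))), lintegral_add_left hm1,
          lintegral_const, measure_univ, mul_one]
    _ ≤ _ := by gcongr

end Causal

/-! ### Existence and integrability of barycenters -/

theorem mainTheorem7 {T N : ℕ} [NeZero N]
    {S : Fin T → Type u} {R : Fin T → Type v}
    [∀ t, TopologicalSpace (S t)] [∀ t, PolishSpace (S t)]
    [∀ t, MeasurableSpace (S t)] [∀ t, BorelSpace (S t)]
    [∀ t, MetricSpace (R t)] [∀ t, CompleteSpace (R t)] [∀ t, SecondCountableTopology (R t)]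
    [∀ t, MeasurableSpace (R t)] [∀ t, BorelSpace (R t)]
    (𝕏 : Fin N → FilteredProcess.{u, w} S)
    (c : Fin N → (∀ t, S t) × (∀ t, R t) → ℝ)
    (hc_lsc : ∀ i, LowerSemicontinuous (c i))
    (hc_bdd : ∀ i, ∃ b : ℝ, ∀ p, b ≤ c i p)
    (y₀ : ∀ t, R t)
    (h_compact : ∀ K : ℝ, 0 ≤ K → IsCompact {y : ∀ t, R t | pathDist y₀ y ≤ K})
    (h_finite : causalBaryFunctional c 𝕏 (FilteredProcess.const y₀) < ⊤)
    (C : ℝ) (hC : 0 ≤ C) (ℓ : (∀ t, S t) → ℝ)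
    (hℓ : Integrable ℓ ((𝕏 0).P.map (𝕏 0).proc))
    (h_growth : ∀ x y, pathDist y₀ y ≤ C * (1 + c 0 (x, y) + ℓ x)) :
    (∃ 𝕐 : FilteredProcess.{v, v} R, IsCausalBarycenter c 𝕏 𝕐) ∧
    (∃ μ : ProbabilityMeasure (∀ t, R t),
      IsCausalBarycenter c 𝕏 (FilteredProcess.canonical μ)) ∧
    (∀ 𝕐 : FilteredProcess.{v, v} R, IsCausalBarycenter c 𝕏 𝕐 → 𝕐.HasFiniteFirstMoment) := by
  choose b hb using hc_bdd
  have hcm : ∀ i, Measurable (c i) := fun i => (hc_lsc i).measurable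
  set V : FilteredProcess.{v, v} R → ℝ≥0∞ := fun 𝕐 =>
    ∑ i, causalValueENNReal (fun p => c i p - b i) (𝕏 i) 𝕐 with hV
  have hiff : ∀ 𝕐, IsCausalBarycenter c 𝕏 𝕐 ↔ ∀ 𝕐', V 𝕐 ≤ V 𝕐' :=
    isCausalBarycenter_iff hcm hb 𝕏
  have hfin : V (FilteredProcess.const y₀) < ⊤ := by
    rw [causalBaryFunctional_eq_add hcm hb] at h_finite
    refine lt_top_iff_ne_top.2 fun h => h_finite.ne ?_
    change ((V (FilteredProcess.const y₀) : ℝ≥0∞) : EReal) + _ = _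
    rw [h, EReal.coe_ennreal_top, EReal.top_add_coe]
  -- `v + 1` appears because the moment lemma needs a strict bound on the value, in order to choose
  -- a coupling below it.
  set D : ℝ≥0∞ → ℝ≥0∞ := fun v => ENNReal.ofReal C * ((v + 1) + ENNReal.ofReal (1 + |b 0|) +
    ∫⁻ x, ‖ℓ x‖ₑ ∂((𝕏 0).P.map (𝕏 0).proc))
  have hDtop : ∀ {v}, v < ⊤ → D v < ⊤ := fun {v} hv =>
    ENNReal.mul_lt_top ENNReal.ofReal_lt_top (ENNReal.add_lt_top.2
      ⟨ENNReal.add_lt_top.2 ⟨ENNReal.add_lt_top.2 ⟨hv, ENNReal.one_lt_top⟩,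
        ENNReal.ofReal_lt_top⟩, hℓ.2⟩)
  have hmoment : ∀ (𝕐 : FilteredProcess.{v, v} R) (v : ℝ≥0∞), v < ⊤ → V 𝕐 ≤ v →
      ∫⁻ ω, ENNReal.ofReal (pathDist y₀ (𝕐.proc ω)) ∂𝕐.P ≤ D v := by
    intro 𝕐 v hv h
    refine lintegral_pathDist_le_of_causalValueENNReal_lt (hcm 0) (hb 0) hC hℓ.1.aemeasurable
      h_growth ?_
    calc _ ≤ V 𝕐 := Finset.single_le_sum (f := fun i =>
          causalValueENNReal (fun p => c i p - b i) (𝕏 i) 𝕐) (fun _ _ => zero_le) (Finset.mem_univ 0)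
      _ ≤ v := h
      _ < v + 1 := ENNReal.lt_add_right hv.ne one_ne_zero
  have hlaw : ∀ 𝕐, V (FilteredProcess.canonical 𝕐.law) ≤ V 𝕐 := fun 𝕐 =>
    Finset.sum_le_sum fun i _ => causalValueENNReal_canonical_law_le _ _ _
  have hlsc : LowerSemicontinuous fun μ : ProbabilityMeasure (∀ t, R t) =>
      V (FilteredProcess.canonical μ) := by
    refine lowerSemicontinuous_sum fun i _ => ?_
    refine lowerSemicontinuous_causalValueENNReal_canonical ?_ (fun p => sub_nonneg.2 (hb i p)) _
    simpa only [sub_eq_add_neg] using (hc_lsc i).add lowerSemicontinuous_const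
  obtain ⟨μ, hμ⟩ : ∃ μ : ProbabilityMeasure (∀ t, R t),
      ∀ 𝕐, V (FilteredProcess.canonical μ) ≤ V 𝕐 := by
    set v₀ := V (FilteredProcess.const y₀)
    -- Sublevel set at the value of the deterministic process; it contains the law of that process,
    -- so a minimiser over it also beats every competitor above `v₀`.
    set K := {μ : ProbabilityMeasure (∀ t, R t) | V (FilteredProcess.canonical μ) ≤ v₀}
    have hKclosed : IsClosed K := hlsc.isClosed_preimage v₀
    have hKcompact : IsCompact K := by
      rw [← hKclosed.closure_eq]
      refine isCompact_closure_of_isTightMeasureSet ?_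
      refine isTightMeasureSet_of_lintegral_le (continuous_pathDist y₀).measurable h_compact
        (hDtop hfin).ne ?_
      rintro _ ⟨μ, hμ, rfl⟩
      exact hmoment (FilteredProcess.canonical μ) v₀ hfin hμ
    obtain ⟨μ, hμK, hμ⟩ := LowerSemicontinuousOn.exists_isMinOn
      ⟨(FilteredProcess.const y₀ : FilteredProcess.{v, v} R).law, hlaw _⟩ hKcompact
      (hlsc.lowerSemicontinuousOn K)
    refine ⟨μ, fun 𝕐 => ?_⟩
    rcases le_total (V 𝕐) v₀ with h | h
    · exact (hμ ((hlaw 𝕐).trans h)).trans (hlaw 𝕐)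
    · exact le_trans hμK h
  have hbary := (hiff _).2 hμ
  refine ⟨⟨_, hbary⟩, ⟨μ, hbary⟩, fun 𝕐 h𝕐 => ⟨y₀, ?_⟩⟩
  have hle := (hiff 𝕐).1 h𝕐 (FilteredProcess.const y₀)
  simp_rw [pathDist_comm _ y₀]
  refine ⟨((continuous_pathDist y₀).measurable.comp 𝕐.measurable_proc).aestronglyMeasurable, ?_⟩
  rw [hasFiniteIntegral_iff_ofReal (ae_of_all _ fun ω => pathDist_nonneg _ _)]
  exact (hmoment 𝕐 _ hfin hle).trans_lt (hDtop hfin)
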